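/- Let $k$ be a field and let $X$ be a smooth variety over $k$ (a smooth separated scheme of finite type over $k$; irreducibility is not needed). Let $r\ge 0$ and let $D_1,\dots,D_r\subset X$ be effective (Cartier) divisors, i.e. closed subschemes each of whose ideal sheaves is locally generated by one nonzerodivisor. Assume that for every subset $S\subseteq\{1,\dots,r\}$ the intersection $\bigcap_{i\in S}D_i$ is either empty or of codimension $|S|$ in $X$. Let $D=D_1\cup\dots\cup D_r$ be the closed subscheme whose ideal sheaf is the intersection of the ideal sheaves of the $D_i$, and for $i_0<\dots<i_p$ let $D_{i_0}\cap\dots\cap D_{i_p}$ be the closed subscheme whose ideal sheaf is the sum of those of $D_{i_0},\dots,D_{i_p}$. Then the Mayer–Vietoris sheaf sequence $$0\to\mathcal O_D\to\bigoplus_{i}\mathcal O_{D_i}\to\bigoplus_{i<j}\mathcal O_{D_i\cap D_j}\to\cdots\to\mathcal O_{D_1\cap\dots\cap D_r}\to 0,$$ whose first map is restriction to each $D_i$ and whose further maps are given by $$(d^p\phi)_{i_0\dots i_{p+1}}=\sum_{j=0}^{p+1}(-1)^j\,\phi_{i_0\dots\widehat{i_j}\dots i_{p+1}}\big|_{D_{i_0}\cap\dots\cap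 D_{i_{p+1}}},$$ is an exact sequence of $\mathcal O_X$-modules. -/

import Mathlib

universe u

open CategoryTheory CategoryTheory.Limits AlgebraicGeometry

noncomputable section

namespace MayerVietoris

variable {X : Scheme.{u}}

attribute [local instance] Abelian.hasFiniteBiproducts

/-- An effective Cartier divisor, given by its ideal sheaf `𝒪_X(-D)`: a quasi-coherent ideal sheaf
which around every point is generated by one nonzerodivisor. -/
def IsEffectiveCartierDivisor (I : X.IdealSheafData) : Prop :=
  ∀ x : X, ∃ U : X.affineOpens, x ∈ U.1 ∧
    ∃ f ∈ nonZeroDivisors Γ(X, U.1), I.ideal U = Ideal.span {f}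

/-- The codimension of a (closed) subset `Z` of a scheme. In the specialization order, the coheight
of a point `x` is the codimension of the closure of `x`, that is `dim 𝒪_{X,x}`, so this is the
smallest codimension of an irreducible closed subset of `Z` (it is `⊤` if `Z` is empty). -/
def codim (Z : Set X) : ℕ∞ := ⨅ x ∈ Z, Order.coheight x

/-- The `𝒪_X`-module `𝒪_Z = ι_* 𝒪_Z`, where `ι : Z ⟶ X` is the closed subscheme with ideal
sheaf `I`. -/
def structureModule (I : X.IdealSheafData) : X.Modules :=
  (Scheme.Modules.pushforward I.subschemeι).obj
    (SheafOfModules.unit I.subscheme.ringCatSheaf)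

/-- The map of `𝒪_Z`-modules `𝒪_Z ⟶ f_* 𝒪_W` given by a morphism of schemes `f : W ⟶ Z`. -/
def pullbackFunctions {W Z : Scheme.{u}} (f : W ⟶ Z) :
    (SheafOfModules.unit Z.ringCatSheaf : Z.Modules) ⟶
      (Scheme.Modules.pushforward f).obj (SheafOfModules.unit W.ringCatSheaf) :=
  SheafOfModules.unitToPushforwardObjUnit f.toRingCatSheafHom

/-- For closed subschemes `W ⊆ Z` with ideal sheaves `I ≤ J`, the restriction of functions
`𝒪_Z ⟶ 𝒪_W`: push forward `𝒪_Z ⟶ (W ⟶ Z)_* 𝒪_W` to `X`. -/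
def restrict {I J : X.IdealSheafData} (h : I ≤ J) : structureModule I ⟶ structureModule J :=
  (Scheme.Modules.pushforward I.subschemeι).map
      (pullbackFunctions (Scheme.IdealSheafData.inclusion h)) ≫
    (Scheme.Modules.pushforwardComp (Scheme.IdealSheafData.inclusion h) I.subschemeι).hom.app _ ≫
    (Scheme.Modules.pushforwardCongr (Scheme.IdealSheafData.inclusion_subschemeι h)).hom.app _

/-- On sections over `U`, `restrict` is the pullback of functions along the inclusion `W ⟶ Z`. -/
lemma restrict_app {I J : X.IdealSheafData} (h : I ≤ J) (U : X.Opens) :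
    (restrict h).app U = (forget₂ CommRingCat RingCat ⋙ forget₂ RingCat Ab).map
      ((Scheme.IdealSheafData.inclusion h).appLE (I.subschemeι ⁻¹ᵁ U) (J.subschemeι ⁻¹ᵁ U)
        (by rw [← Scheme.Hom.comp_preimage, Scheme.IdealSheafData.inclusion_subschemeι])) := by
  rfl

lemma restrict_comp {I J K : X.IdealSheafData} (h : I ≤ J) (h' : J ≤ K) :
    restrict h ≫ restrict h' = restrict (h.trans h') := by
  apply Scheme.Modules.hom_ext
  intro U
  rw [Scheme.Modules.Hom.comp_app, restrict_app, restrict_app, restrict_app]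
  refine (Functor.map_comp _ _ _).symm.trans (congrArg _ ?_)
  rw [Scheme.Hom.appLE_comp_appLE]
  simp only [Scheme.IdealSheafData.inclusion_comp]

variable {r : ℕ} (D : Fin r → X.IdealSheafData)

/-- The ideal sheaf of the union `D_1 ∪ … ∪ D_r`. -/
def unionIdeal : X.IdealSheafData := ⨅ i, D i

/-- The ideal sheaf of the intersection `D_{i_0} ∩ … ∩ D_{i_p}`, for `i_0 < … < i_p`. -/
def interIdeal {p : ℕ} (φ : Fin (p + 1) ↪o Fin r) : X.IdealSheafData := ⨆ a, D (φ a)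

/-- The index set `(i_0, …, î_j, …, i_{p+1})`. -/
def face {p : ℕ} (φ : Fin (p + 2) ↪o Fin r) (j : Fin (p + 2)) : Fin (p + 1) ↪o Fin r :=
  j.succAboveOrderEmb.trans φ

lemma interIdeal_face_le {p : ℕ} (φ : Fin (p + 2) ↪o Fin r) (j : Fin (p + 2)) :
    interIdeal D (face φ j) ≤ interIdeal D φ :=
  iSup_le fun a => le_iSup (fun b => D (φ b)) (j.succAbove a)

lemma unionIdeal_le_interIdeal {p : ℕ} (φ : Fin (p + 1) ↪o Fin r) :
    unionIdeal D ≤ interIdeal D φ :=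
  (iInf_le D (φ 0)).trans (le_iSup (fun b => D (φ b)) 0)

/-- `M^p = ⨁_{i_0 < … < i_p} 𝒪_{D_{i_0} ∩ … ∩ D_{i_p}}`. -/
def sheafTerm (p : ℕ) : X.Modules :=
  ⨁ fun φ : Fin (p + 1) ↪o Fin r => structureModule (interIdeal D φ)

/-- The projection `f ↦ f_{i_0 … i_p}`. -/
def proj (p : ℕ) (φ : Fin (p + 1) ↪o Fin r) : sheafTerm D p ⟶ structureModule (interIdeal D φ) :=
  biproduct.π _ φ

/-- `(d f)_{i_0 … i_{p+1}} = ∑_j (-1)^j f_{i_0 … î_j … i_{p+1}}`, restricted to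
`D_{i_0} ∩ … ∩ D_{i_{p+1}}`. -/
def diff (p : ℕ) : sheafTerm D p ⟶ sheafTerm D (p + 1) :=
  biproduct.lift fun φ => ∑ j : Fin (p + 2), (-1 : ℤ) ^ (j : ℕ) •
    (proj D p (face φ j) ≫ restrict (interIdeal_face_le D φ j))

/-- The map `𝒪_D ⟶ ⨁ 𝒪_{D_i}` given by restriction to each `D_i`. -/
def augmentation : structureModule (unionIdeal D) ⟶ sheafTerm D 0 :=
  biproduct.lift fun φ => restrict (unionIdeal_le_interIdeal D φ)

lemma diff_proj (p : ℕ) (φ : Fin (p + 2) ↪o Fin r) :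
    diff D p ≫ proj D (p + 1) φ = ∑ j : Fin (p + 2), (-1 : ℤ) ^ (j : ℕ) •
      (proj D p (face φ j) ≫ restrict (interIdeal_face_le D φ j)) :=
  biproduct.lift_π _ _

lemma augmentation_proj (φ : Fin 1 ↪o Fin r) :
    augmentation D ≫ proj D 0 φ = restrict (unionIdeal_le_interIdeal D φ) :=
  biproduct.lift_π _ _

lemma proj_restrict_congr {p : ℕ} {J : X.IdealSheafData} {ψ ψ' : Fin (p + 1) ↪o Fin r}
    (e : ψ = ψ') (h : interIdeal D ψ ≤ J) (h' : interIdeal D ψ' ≤ J) :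
    proj D p ψ ≫ restrict h = proj D p ψ' ≫ restrict h' := by
  subst e
  rfl

lemma neg_one_pow_succAbove {n : ℕ} (i : Fin (n + 2)) (j : Fin (n + 1)) :
    (-1 : ℤ) ^ ((i.succAbove j : ℕ) + (j.predAbove i : ℕ)) = -(-1) ^ ((i : ℕ) + j) := by
  rcases Fin.lt_or_le j.castSucc i with h | h
  · rw [Fin.succAbove_of_castSucc_lt _ _ h, Fin.predAbove_of_castSucc_lt _ _ h]
    obtain ⟨i', rfl⟩ := Fin.exists_succ_eq.2 (Fin.ne_zero_of_lt h)
    simp only [Fin.val_castSucc, Fin.pred_succ, Fin.val_succ]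
    ring
  · rw [Fin.succAbove_of_le_castSucc _ _ h, Fin.predAbove_of_le_castSucc _ _ h]
    simp only [Fin.val_succ, Fin.coe_castPred]
    ring

lemma diff_comp_diff (p : ℕ) : diff D p ≫ diff D (p + 1) = 0 := by
  refine biproduct.hom_ext _ _ fun φ => ?_
  change (diff D p ≫ diff D (p + 1)) ≫ proj D (p + 2) φ = 0 ≫ _
  simp only [Category.assoc, diff_proj, Preadditive.comp_sum, Preadditive.comp_zsmul, zero_comp,
    reassoc_of% diff_proj, Preadditive.sum_comp, Preadditive.zsmul_comp, restrict_comp, smul_smul,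
    ← pow_add, Finset.smul_sum]
  rw [← Finset.sum_product']
  refine Finset.sum_involution
    (fun x _ => (x.1.succAbove x.2, x.2.predAbove x.1)) ?_ ?_ ?_ ?_
  · rintro ⟨i, j⟩ -
    dsimp only
    rw [proj_restrict_congr D (ψ := face (face φ (i.succAbove j)) (j.predAbove i))
      (ψ' := face (face φ i) j) ?_ _
      ((interIdeal_face_le D _ _).trans (interIdeal_face_le D _ _)), ← add_smul,
      neg_one_pow_succAbove, add_neg_cancel, zero_smul]
    ext k
    simp [face, Fin.succAbove_succAbove_succAbove_predAbove]
  · rintro ⟨i, j⟩ - - h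
    exact Fin.succAbove_ne i j (congrArg Prod.fst h)
  · simp
  · rintro ⟨i, j⟩ -
    simp [Fin.succAbove_succAbove_predAbove, Fin.predAbove_predAbove_succAbove]

lemma augmentation_comp_diff : augmentation D ≫ diff D 0 = 0 := by
  refine biproduct.hom_ext _ _ fun φ => ?_
  change (augmentation D ≫ diff D 0) ≫ proj D 1 φ = 0 ≫ _
  simp [diff_proj, reassoc_of% augmentation_proj, Fin.sum_univ_succ, restrict_comp,
    Preadditive.comp_add, Preadditive.comp_neg]

/-- The complex `0 → ⨁ 𝒪_{D_i} → ⨁ 𝒪_{D_i ∩ D_j} → …`. -/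
def unaugmentedComplex : CochainComplex X.Modules ℕ :=
  CochainComplex.of (sheafTerm D) (diff D) (diff_comp_diff D)

/-- The Mayer–Vietoris sheaf sequence
`0 → 𝒪_D → ⨁ 𝒪_{D_i} → ⨁ 𝒪_{D_i ∩ D_j} → … → 𝒪_{D_1 ∩ … ∩ D_r} → 0`, with `𝒪_D` in degree `0`
(so that `M^p` sits in degree `p + 1`). -/
def mayerVietorisComplex : CochainComplex X.Modules ℕ :=
  (unaugmentedComplex D).augment (augmentation D) (by
    exact (congrArg (augmentation D ≫ ·) (CochainComplex.of_d _ _ 0)).trans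
      (augmentation_comp_diff D))

end MayerVietoris

end

/-! Exactness is local, so it suffices to work on affine opens `W` where each `D i` has one equation
`f i`. There, with `A = Γ(X, W)`, the sequence is the complex of the quotients `A / (f i, i ∈ S)`,
and the claim splits into two parts.

Algebra: if the `f i` form a weakly regular sequence in every order, the complex is exact
(`exists_coboundary_sub_mem`). The proof is induction on the number of equations. Splitting subsets
by whether they contain the largest index `m` presents the complex as a mapping cone of the complex
of the remaining equations mapping to its reduction modulo `f m`. The only correction needed is in
lowest degree, where an intersection of principal ideals is generated by the product
(`IsPermutablyRegular.mem_sup_span_prod`).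

Geometry: a smooth `X` is Cohen–Macaulay, being locally étale over affine space. In a Cohen–Macaulay
ring, elements whose partial intersections have the expected codimension form a regular sequence in
any order (`IsCohenMacaulay.isPermutablyRegular`). Weak regularity is the right notion because
intersections may be empty. -/

noncomputable section

namespace MayerVietoris

/-! ### Čech-type complexes of permutable regular sequences. -/

section Cochains

variable {ι A : Type*} [CommRing A]

/-- The ideal generated by `J` and the elements `f i` for `i ∈ S`. -/
def adjoinIdeal (J : Ideal A) (f : ι → A) (S : Finset ι) : Ideal A :=
  J ⊔ Ideal.span (f '' S)

lemma adjoinIdeal_mono (J : Ideal A) (f : ι → A) {S T : Finset ι} (h : S ⊆ T) :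
    adjoinIdeal J f S ≤ adjoinIdeal J f T :=
  sup_le_sup_left (Ideal.span_mono (Set.image_mono (Finset.coe_subset.2 h))) _

@[simp]
lemma adjoinIdeal_empty (J : Ideal A) (f : ι → A) : adjoinIdeal J f ∅ = J := by
  simp [adjoinIdeal]

lemma adjoinIdeal_insert [DecidableEq ι] (J : Ideal A) (f : ι → A) (m : ι) (S : Finset ι) :
    adjoinIdeal J f (insert m S) = adjoinIdeal (J ⊔ Ideal.span {f m}) f S := by
  simp [adjoinIdeal, Set.image_insert_eq, Ideal.span_insert, sup_assoc]

lemma adjoinIdeal_singleton (J : Ideal A) (f : ι → A) (m : ι) :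
    adjoinIdeal J f {m} = J ⊔ Ideal.span {f m} := by
  simp [adjoinIdeal]

/-- Modulo `J`, the elements `f i` for `i ∈ T` form a weakly regular sequence in any order. -/
def IsPermutablyRegular (J : Ideal A) (f : ι → A) (T : Finset ι) : Prop :=
  ∀ S ⊆ T, ∀ i ∈ T, i ∉ S → ∀ x, f i * x ∈ adjoinIdeal J f S → x ∈ adjoinIdeal J f S

namespace IsPermutablyRegular

variable [DecidableEq ι] {J : Ideal A} {f : ι → A} {T : Finset ι} {m : ι}

lemma of_insert (h : IsPermutablyRegular J f (insert m T)) : IsPermutablyRegular J f T :=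
  fun S hS i hi hiS => h S (hS.trans (Finset.subset_insert _ _)) i (Finset.mem_insert_of_mem hi) hiS

lemma sup_span_singleton (hm : m ∉ T) (h : IsPermutablyRegular J f (insert m T)) :
    IsPermutablyRegular (J ⊔ Ideal.span {f m}) f T := by
  intro S hS i hi hiS x hx
  rw [← adjoinIdeal_insert] at hx ⊢
  refine h _ (Finset.insert_subset_insert _ hS) i (Finset.mem_insert_of_mem hi) ?_ x hx
  rw [Finset.mem_insert, not_or]
  exact ⟨fun e => hm (e ▸ hi), hiS⟩

/-- For permutable regular sequences, the intersection of the principal ideals is the ideal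
generated by the product. -/
lemma mem_sup_span_prod (h : IsPermutablyRegular J f T) {a : A}
    (ha : ∀ i ∈ T, a ∈ J ⊔ Ideal.span {f i}) (hT : T.Nonempty) :
    a ∈ J ⊔ Ideal.span {∏ i ∈ T, f i} := by
  induction T using Finset.induction_on with
  | empty => simp at hT
  | insert m T hm ih =>
    rcases T.eq_empty_or_nonempty with rfl | hT'
    · simpa using ha
    obtain ⟨j, hj, y, hy, rfl⟩ := Submodule.mem_sup.1
      (ih h.of_insert (fun i hi => ha i (Finset.mem_insert_of_mem hi)) hT')
    obtain ⟨c, rfl⟩ := Ideal.mem_span_singleton'.1 hy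
    -- Each `f i` with `i ∈ T` is a nonzerodivisor modulo `J + (f m)`, so the factors cancel one at
    -- a time.
    have hc : ∀ S ⊆ T, (∏ i ∈ S, f i) * c ∈ J ⊔ Ideal.span {f m} →
        c ∈ J ⊔ Ideal.span {f m} := by
      intro S
      induction S using Finset.induction_on with
      | empty => simp
      | insert i S hi ihS =>
        intro hS hc
        have hi' : i ∈ T := hS (Finset.mem_insert_self _ _)
        refine ihS ((Finset.subset_insert _ _).trans hS) ?_
        have := h.sup_span_singleton hm ∅ (Finset.empty_subset _) i hi' (Finset.notMem_empty _)
          ((∏ i ∈ S, f i) * c)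
        simp only [adjoinIdeal_empty] at this
        exact this (by rwa [Finset.prod_insert hi, mul_assoc] at hc)
    have h1 : (∏ i ∈ T, f i) * c ∈ J ⊔ Ideal.span {f m} := by
      have := ha m (Finset.mem_insert_self _ _)
      rw [mul_comm]
      exact (Ideal.add_mem_iff_right _ (le_sup_left (a := J) hj)).1 this
    obtain ⟨j', hj', y', hy', rfl⟩ := Submodule.mem_sup.1 (hc T subset_rfl h1)
    obtain ⟨c', rfl⟩ := Ideal.mem_span_singleton'.1 hy'
    rw [add_mul, ← add_assoc, Finset.prod_insert hm]
    refine Submodule.add_mem_sup (J.add_mem hj (J.mul_mem_right _ hj')) ?_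
    exact Ideal.mem_span_singleton'.2 ⟨c', by ring⟩

end IsPermutablyRegular

variable [LinearOrder ι]

/-- The simplicial coboundary of a family of elements indexed by the finite subsets of `ι`. -/
def coboundary (a : Finset ι → A) (S : Finset ι) : A :=
  ∑ i ∈ S, (-1) ^ (S.filter (· < i)).card * a (S.erase i)

lemma coboundary_congr {a b : Finset ι → A} {S : Finset ι}
    (h : ∀ i ∈ S, a (S.erase i) = b (S.erase i)) :
    coboundary a S = coboundary b S :=
  Finset.sum_congr rfl fun i hi => by rw [h i hi]

/-- As `m` is the largest element, it sits in position `S.card` and leaves the signs of the other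
elements unchanged. -/
lemma coboundary_insert (a : Finset ι → A) {S : Finset ι} {m : ι} (h : ∀ i ∈ S, i < m) :
    coboundary a (insert m S) =
      (-1) ^ S.card * a S + coboundary (fun R => a (insert m R)) S := by
  have hm : m ∉ S := fun hm => (h m hm).false
  rw [coboundary, Finset.sum_insert hm, Finset.erase_insert hm, Finset.filter_insert,
    if_neg (lt_irrefl m), Finset.filter_true_of_mem h]
  congr 1
  refine Finset.sum_congr rfl fun i hi => ?_
  rw [Finset.filter_insert, if_neg (h i hi).not_gt,
    Finset.erase_insert_of_ne (h i hi).ne']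

lemma coboundary_sub (a b : Finset ι → A) (S : Finset ι) :
    coboundary (fun R => a R - b R) S = coboundary a S - coboundary b S := by
  simp [coboundary, mul_sub]

lemma coboundary_sign_mul (a : Finset ι → A) (S : Finset ι) :
    coboundary (fun R => (-1) ^ R.card * a R) S = -((-1) ^ S.card * coboundary a S) := by
  rw [coboundary, coboundary, Finset.mul_sum, ← Finset.sum_neg_distrib]
  refine Finset.sum_congr rfl fun i hi => ?_
  rw [← Finset.card_erase_add_one hi]
  ring

/-- Exactness of the Čech-type complex with terms `⨁_{|S| = p} A / (J + (f_i, i ∈ S))` in positive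
degrees, for a permutable regular sequence. -/
theorem exists_coboundary_sub_mem {J : Ideal A} {f : ι → A} {T : Finset ι}
    (h : IsPermutablyRegular J f T) (a : Finset ι → A)
    (ha : ∀ S ⊆ T, coboundary a S ∈ adjoinIdeal J f S) :
    ∃ b : Finset ι → A, ∀ S ⊆ T, S.Nonempty → a S - coboundary b S ∈ adjoinIdeal J f S := by
  induction T using Finset.induction_on_max generalizing J a with
  | empty => exact ⟨0, fun S hS hS' => absurd (Finset.subset_empty.1 hS) hS'.ne_empty⟩
  | insert m T hm ih =>
    have hmT : m ∉ T := fun h => (hm m h).false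
    obtain ⟨b, hb⟩ := ih h.of_insert a fun S hS => ha S (hS.trans (Finset.subset_insert _ _))
    -- After `a` is corrected by the coboundary of `b` on subsets of `T`, what remains is carried by
    -- sets containing `m`. The sign makes this remainder a cocycle modulo `J + (f m)`.
    let c : Finset ι → A := fun S => a (insert m S) - (-1) ^ S.card * b S
    have hc : ∀ S ⊆ T, coboundary c S ∈ adjoinIdeal (J ⊔ Ideal.span {f m}) f S := by
      intro S hS
      rcases S.eq_empty_or_nonempty with rfl | hS'
      · simp [coboundary]
      have h1 := ha _ (Finset.insert_subset_insert m hS)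
      rw [coboundary_insert _ fun i hi => hm i (hS hi)] at h1
      have h2 := Ideal.mul_mem_left _ ((-1) ^ S.card)
        (adjoinIdeal_mono J f (Finset.subset_insert m S) (hb S hS hS'))
      rw [← adjoinIdeal_insert, coboundary_sub, coboundary_sign_mul]
      convert Ideal.sub_mem _ h1 h2 using 1
      ring
    obtain ⟨e, he⟩ := ih (h.sup_span_singleton hmT) c hc
    -- The induction hypothesis for `c` says nothing at `∅`, so `b ∅` needs a correction `β` that
    -- repairs the set `{m}` without disturbing any `{i}`. The cocycle condition at each `{i}` puts
    -- `c ∅` in `J + (f m) + (∏ f i)`, and `β` is its component in the product ideal.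
    obtain ⟨β, hβ, hβm⟩ : ∃ β, (∀ i ∈ T, β ∈ J ⊔ Ideal.span {f i}) ∧
        c ∅ - β ∈ J ⊔ Ideal.span {f m} := by
      rcases T.eq_empty_or_nonempty with rfl | hT
      · exact ⟨c ∅, by simp, by simp⟩
      have h0 : c ∅ ∈ (J ⊔ Ideal.span {f m}) ⊔ Ideal.span {∏ i ∈ T, f i} := by
        refine (h.sup_span_singleton hmT).mem_sup_span_prod (fun i hi => ?_) hT
        have := hc {i} (Finset.singleton_subset_iff.2 hi)
        rw [adjoinIdeal_singleton] at this
        simpa [coboundary, Finset.filter_singleton] using this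
      obtain ⟨j, hj, y, hy, hjy⟩ := Submodule.mem_sup.1 h0
      refine ⟨y, fun i hi => ?_, by rwa [← hjy, add_sub_cancel_right]⟩
      refine le_sup_right (a := J) ((Ideal.span_singleton_le_span_singleton.2 ?_) hy)
      exact Finset.dvd_prod_of_mem f hi
    let b' : Finset ι → A := fun S =>
      if m ∈ S then e (S.erase m) else if S = ∅ then b ∅ + β else b S
    refine ⟨b', fun S hS hS' => ?_⟩
    by_cases hmS : m ∈ S
    · obtain ⟨S, hmS', rfl⟩ : ∃ R, m ∉ R ∧ S = insert m R :=
        ⟨S.erase m, Finset.notMem_erase _ _, (Finset.insert_erase hmS).symm⟩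
      have hST : S ⊆ T := fun i hi =>
        (Finset.mem_insert.1 (hS (Finset.mem_insert_of_mem hi))).resolve_left
          fun h => hmS' (h ▸ hi)
      rw [coboundary_insert _ fun i hi => hm i (hST hi), adjoinIdeal_insert]
      have hbe : coboundary (fun R => b' (insert m R)) S = coboundary e S :=
        coboundary_congr fun i hi => by
          have : m ∉ S.erase i := fun h => hmS' (Finset.mem_of_mem_erase h)
          simp [b', Finset.erase_insert this]
      rw [hbe]
      rcases S.eq_empty_or_nonempty with rfl | hS'
      · simpa [coboundary, b', c, sub_sub] using hβm
      · convert he S hST hS' using 1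
        simp only [b', c, if_neg hmS', if_neg hS'.ne_empty]
        ring
    · have hST : S ⊆ T := fun i hi =>
        (Finset.mem_insert.1 (hS hi)).resolve_left fun h => hmS (h ▸ hi)
      -- Among the sets without `m`, only singletons have `∅` as a face and so see `β`.
      by_cases hS1 : S.card = 1
      · obtain ⟨i, rfl⟩ := Finset.card_eq_one.1 hS1
        have h1 := hb {i} hST hS'
        have h2 := hβ i (Finset.singleton_subset_iff.1 hST)
        rw [adjoinIdeal_singleton] at h1 ⊢
        have := Ideal.sub_mem _ h1 h2
        simpa [coboundary, b', Finset.filter_singleton, sub_sub] using this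
      · convert hb S hST hS' using 2
        refine coboundary_congr fun i hi => ?_
        have h1 : m ∉ S.erase i := fun h => hmS (Finset.mem_of_mem_erase h)
        have h2 : S.erase i ≠ ∅ := fun h => hS1 <| by
          rw [← Finset.card_erase_add_one hi, h, Finset.card_empty]
        simp only [b', if_neg h1, if_neg h2]

/-- The finite set `{i_0, …, i_p}` given by `i_0 < … < i_p`. -/
def rangeFinset {n : ℕ} (φ : Fin n ↪o ι) : Finset ι :=
  Finset.univ.map φ.toEmbedding

lemma rangeFinset_erase {p : ℕ} {r : ℕ} (φ : Fin (p + 2) ↪o Fin r) (j : Fin (p + 2)) :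
    (rangeFinset φ).erase (φ j) = rangeFinset (face φ j) := by
  ext i
  simp only [rangeFinset, Finset.mem_erase, Finset.mem_map, Finset.mem_univ, true_and, face]
  constructor
  · rintro ⟨h, k, rfl⟩
    obtain ⟨l, rfl⟩ := Fin.exists_succAbove_eq (x := k) (y := j) (fun e => h (e ▸ rfl))
    exact ⟨l, (rfl : (φ (j.succAbove l) : Fin r) = _)⟩
  · rintro ⟨l, rfl⟩
    exact ⟨fun h => Fin.succAbove_ne j l (φ.injective h), _, rfl⟩

lemma coboundary_rangeFinset {p r : ℕ} (b : Finset (Fin r) → A) (φ : Fin (p + 2) ↪o Fin r) :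
    coboundary b (rangeFinset φ) =
      ∑ j : Fin (p + 2), (-1) ^ (j : ℕ) * b (rangeFinset (face φ j)) := by
  rw [coboundary, rangeFinset, Finset.sum_map]
  refine Finset.sum_congr rfl fun j _ => ?_
  rw [Finset.filter_map, Finset.card_map]
  have h1 : (Finset.univ.filter ((· < φ.toEmbedding j) ∘ φ.toEmbedding)) = Finset.Iio j := by
    ext k
    simp
  rw [h1, Fin.card_Iio]
  congr 2
  exact rangeFinset_erase φ j

lemma exists_rangeFinset_eq {n r : ℕ} {S : Finset (Fin r)} (h : S.card = n) :
    ∃ φ : Fin n ↪o Fin r, rangeFinset φ = S := by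
  refine ⟨S.orderEmbOfFin h, ?_⟩
  rw [rangeFinset]
  exact Finset.map_orderEmbOfFin_univ S h

lemma card_rangeFinset {n : ℕ} (φ : Fin n ↪o ι) : (rangeFinset φ).card = n := by
  simp [rangeFinset]

lemma rangeFinset_injective {n : ℕ} : Function.Injective (rangeFinset (ι := ι) (n := n)) := by
  intro φ ψ h
  refine OrderEmbedding.range_inj.1 ?_
  simpa [rangeFinset] using congrArg (fun S : Finset ι => (S : Set ι)) h

end Cochains

/-! ### Passage from finite subsets to increasing sequences of indices. -/

section OrderedCochains

variable {r : ℕ} {A : Type*} [CommRing A] {f : Fin r → A}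

/-- A family indexed by increasing sequences of length `n`, extended by zero to all finite sets. -/
def extendFamily {n : ℕ} (a : (Fin n ↪o Fin r) → A) (S : Finset (Fin r)) : A :=
  if h : ∃ φ, rangeFinset φ = S then a h.choose else 0

lemma extendFamily_rangeFinset {n : ℕ} (a : (Fin n ↪o Fin r) → A) (φ : Fin n ↪o Fin r) :
    extendFamily a (rangeFinset φ) = a φ := by
  have h : ∃ ψ, rangeFinset ψ = rangeFinset φ := ⟨φ, rfl⟩
  rw [extendFamily, dif_pos h, rangeFinset_injective h.choose_spec]

lemma extendFamily_of_card_ne {n : ℕ} (a : (Fin n ↪o Fin r) → A) {S : Finset (Fin r)}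
    (h : S.card ≠ n) : extendFamily a S = 0 :=
  dif_neg fun ⟨φ, hφ⟩ => h (hφ ▸ card_rangeFinset φ)

lemma exists_forall_sub_coboundary_mem
    (hf : IsPermutablyRegular ⊥ f Finset.univ) {p : ℕ} (a : (Fin (p + 1) ↪o Fin r) → A)
    (ha : ∀ ψ : Fin (p + 2) ↪o Fin r, ∑ j : Fin (p + 2), (-1) ^ (j : ℕ) * a (face ψ j) ∈
      Ideal.span (Set.range (f ∘ ψ))) :
    ∃ b : Finset (Fin r) → A, ∀ φ : Fin (p + 1) ↪o Fin r,
      a φ - coboundary b (rangeFinset φ) ∈ Ideal.span (Set.range (f ∘ φ)) := by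
  have hI : ∀ {n} (φ : Fin n ↪o Fin r),
      adjoinIdeal ⊥ f (rangeFinset φ) = Ideal.span (Set.range (f ∘ φ)) := by
    intro n φ
    simp [adjoinIdeal, rangeFinset, Set.range_comp]
  -- The extension vanishes off cardinality `p + 1`, so the cocycle condition has content only in
  -- cardinality `p + 2`.
  obtain ⟨b, hb⟩ := exists_coboundary_sub_mem hf (extendFamily a) fun S _ => by
    by_cases hS : S.card = p + 2
    · obtain ⟨ψ, rfl⟩ := exists_rangeFinset_eq hS
      rw [coboundary_rangeFinset, hI]
      simpa only [extendFamily_rangeFinset] using ha ψ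
    · rw [coboundary, Finset.sum_eq_zero]
      · exact Ideal.zero_mem _
      · intro i hi
        rw [extendFamily_of_card_ne, mul_zero]
        have := Finset.card_erase_add_one hi
        omega
  refine ⟨b, fun φ => ?_⟩
  have := hb (rangeFinset φ) (Finset.subset_univ _) (Finset.card_pos.1 (by simp [card_rangeFinset]))
  rwa [extendFamily_rangeFinset, hI] at this

/-- Exactness at `⨁ A / (f_i)`. -/
lemma exists_forall_sub_mem
    (hf : IsPermutablyRegular ⊥ f Finset.univ) (a : (Fin 1 ↪o Fin r) → A)
    (ha : ∀ ψ : Fin 2 ↪o Fin r, ∑ j : Fin 2, (-1) ^ (j : ℕ) * a (face ψ j) ∈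
      Ideal.span (Set.range (f ∘ ψ))) :
    ∃ b : A, ∀ φ : Fin 1 ↪o Fin r, a φ - b ∈ Ideal.span (Set.range (f ∘ φ)) := by
  obtain ⟨b, hb⟩ := exists_forall_sub_coboundary_mem hf a ha
  -- The only face of a singleton is `∅`, with sign `+1`.
  refine ⟨b ∅, fun φ => ?_⟩
  simpa [coboundary, rangeFinset, Finset.filter_singleton] using hb φ

/-- Exactness at `⨁ A / (f_{i_0}, …, f_{i_{p+1}})`. -/
lemma exists_forall_sub_sum_mem
    (hf : IsPermutablyRegular ⊥ f Finset.univ) {p : ℕ} (a : (Fin (p + 2) ↪o Fin r) → A)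
    (ha : ∀ ψ : Fin (p + 3) ↪o Fin r, ∑ j : Fin (p + 3), (-1) ^ (j : ℕ) * a (face ψ j) ∈
      Ideal.span (Set.range (f ∘ ψ))) :
    ∃ b : (Fin (p + 1) ↪o Fin r) → A, ∀ φ : Fin (p + 2) ↪o Fin r,
      a φ - ∑ j : Fin (p + 2), (-1) ^ (j : ℕ) * b (face φ j) ∈
        Ideal.span (Set.range (f ∘ φ)) := by
  obtain ⟨b, hb⟩ := exists_forall_sub_coboundary_mem hf a ha
  refine ⟨fun φ => b (rangeFinset φ), fun φ => ?_⟩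
  simpa only [coboundary_rangeFinset] using hb φ

end OrderedCochains

/-! ### Cohen–Macaulay rings: permanence properties and depth. -/

section CohenMacaulay

open IsLocalRing RingTheory.Sequence Abelian

/-- A local ring is Cohen–Macaulay if its maximal ideal contains a regular sequence of length
`dim R`. -/
def IsCohenMacaulayLocal (R : Type*) [CommRing R] [IsLocalRing R] : Prop :=
  ∃ rs : List R, (∀ x ∈ rs, x ∈ maximalIdeal R) ∧ IsWeaklyRegular R rs ∧
    ringKrullDim R ≤ rs.length

/-- A ring is Cohen–Macaulay if its localizations at primes are. -/
def IsCohenMacaulay (R : Type*) [CommRing R] : Prop :=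
  ∀ (p : Ideal R) [p.IsPrime], IsCohenMacaulayLocal (Localization.AtPrime p)

lemma IsCohenMacaulayLocal.of_ringEquiv {R S : Type*} [CommRing R] [IsLocalRing R] [CommRing S]
    [IsLocalRing S] (e : R ≃+* S) (h : IsCohenMacaulayLocal R) : IsCohenMacaulayLocal S := by
  obtain ⟨rs, hrs, hreg, hdim⟩ := h
  refine ⟨rs.map e, ?_, ?_, ?_⟩
  · intro x hx
    obtain ⟨y, hy, rfl⟩ := List.mem_map.1 hx
    rw [← map_ringEquiv_maximalIdeal e]
    exact Ideal.mem_map_of_mem _ (hrs y hy)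
  · refine (e.toAddEquiv.isWeaklyRegular_congr (bs := rs.map e) ?_).1 hreg
    rw [List.forall₂_map_right_iff, List.forall₂_same]
    intro r _ x
    exact map_mul e r x
  · rwa [List.length_map, ← ringKrullDim_eq_of_ringEquiv e]

lemma IsCohenMacaulay.localization {R : Type*} [CommRing R] (h : IsCohenMacaulay R) (p : Ideal R)
    [p.IsPrime] (S : Type*) [CommRing S] [Algebra R S] [IsLocalization.AtPrime S p]
    [IsLocalRing S] : IsCohenMacaulayLocal S :=
  (h p).of_ringEquiv (IsLocalization.algEquiv p.primeCompl (Localization.AtPrime p) S).toRingEquiv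

lemma IsCohenMacaulay.of_ringEquiv {R S : Type*} [CommRing R] [CommRing S] (e : R ≃+* S)
    (h : IsCohenMacaulay R) : IsCohenMacaulay S := by
  intro p hp
  exact (h (p.comap e)).of_ringEquiv <| IsLocalization.ringEquivOfRingEquiv
    (Localization.AtPrime (p.comap e)) (Localization.AtPrime p) e (e.map_primeCompl_comap_eq p)

lemma isCohenMacaulay_of_field (K : Type*) [Field K] : IsCohenMacaulay K := by
  intro p hp
  refine ⟨[], by simp, IsWeaklyRegular.nil _ _, ?_⟩
  rw [IsLocalization.AtPrime.ringKrullDim_eq_height p]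
  simp [Ideal.eq_bot_of_prime p]

/-- The quotient is `(R ⧸ I)[X]`, where `f` stays monic. -/
lemma isSMulRegular_quotient_map_C_of_monic {R : Type*} [CommRing R] (I : Ideal R)
    {f : Polynomial R} (hf : f.Monic) :
    IsSMulRegular (Polynomial R ⧸ I.map Polynomial.C) f := by
  have h : Function.Injective (fun x : Polynomial (R ⧸ I) => f.map (Ideal.Quotient.mk I) * x) :=
    (hf.map _).isRegular.left
  let e := I.polynomialQuotientEquivQuotientPolynomial
  intro x y hxy
  apply e.symm.injective
  apply h
  obtain ⟨x, rfl⟩ := Ideal.Quotient.mk_surjective x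
  obtain ⟨y, rfl⟩ := Ideal.Quotient.mk_surjective y
  have h1 : ∀ z : Polynomial R, f.map (Ideal.Quotient.mk I) * e.symm (Ideal.Quotient.mk _ z) =
      e.symm (f • Ideal.Quotient.mk (I.map Polynomial.C) z) := by
    intro z
    rw [← Ideal.Quotient.mk_eq_mk, ← Submodule.Quotient.mk_smul, Ideal.Quotient.mk_eq_mk,
      smul_eq_mul]
    simp [e, Ideal.polynomialQuotientEquivQuotientPolynomial_symm_mk]
  simp only [h1]
  exact congrArg e.symm hxy

lemma map_algebraMap_mem_maximalIdeal {R : Type*} [CommRing R] {p : Ideal R} [p.IsPrime]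
    {rs : List R} (h : ∀ x ∈ rs, x ∈ p) :
    ∀ x ∈ rs.map (algebraMap R (Localization.AtPrime p)),
      x ∈ maximalIdeal (Localization.AtPrime p) := by
  intro x hx
  obtain ⟨y, hy, rfl⟩ := List.mem_map.1 hx
  exact (IsLocalization.AtPrime.to_map_mem_maximal_iff _ p y).2 (h y hy)

-- By flatness a regular sequence of `R` stays regular in `R[X]`, and the height of `p` exceeds that
-- of the maximal ideal by at most the height of `p` in the fibre. If `p` is extended, that height
-- is `0`. Otherwise `p` is generated over the extended ideal by a monic `y`: the fibre height is at
-- most `1` by Krull, and `y` prolongs the sequence.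
open Polynomial in
lemma isCohenMacaulayLocal_localization_polynomial {R : Type*} [CommRing R] [IsLocalRing R]
    [IsNoetherianRing R] (h : IsCohenMacaulayLocal R) (p : Ideal R[X]) [p.IsPrime]
    (hp : p.comap C = maximalIdeal R) : IsCohenMacaulayLocal (Localization.AtPrime p) := by
  obtain ⟨rs, hrs, hreg, hdim⟩ := h
  have : p.LiesOver (maximalIdeal R) := ⟨hp.symm⟩
  have hht := Ideal.height_le_height_add_of_liesOver (maximalIdeal R) p
  rw [← maximalIdeal_height_eq_ringKrullDim] at hdim
  replace hdim : (maximalIdeal R).height ≤ rs.length := by exact_mod_cast hdim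
  have hreg' : IsWeaklyRegular R[X] (rs.map C) := hreg.of_flat (S := R[X])
  have hmem : ∀ x ∈ rs.map C, x ∈ p := by
    intro x hx
    obtain ⟨y, hy, rfl⟩ := List.mem_map.1 hx
    exact hp.ge (hrs y hy)
  by_cases hp' : p = (maximalIdeal R).map C
  · refine ⟨_, map_algebraMap_mem_maximalIdeal hmem, hreg'.of_isLocalization _ p.primeCompl, ?_⟩
    rw [IsLocalization.AtPrime.ringKrullDim_eq_height p]
    have h0 : (p.map (Ideal.Quotient.mk ((maximalIdeal R).map (algebraMap R R[X])))) = ⊥ := by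
      rw [Ideal.map_eq_bot_iff_le_ker, Ideal.mk_ker, hp']
      rfl
    have : Nontrivial (R[X] ⧸ (maximalIdeal R).map (algebraMap R R[X])) :=
      Ideal.Quotient.nontrivial_iff.2 (by
        rw [Polynomial.algebraMap_eq, ← hp']
        exact Ideal.IsPrime.ne_top')
    rw [h0, Ideal.height_bot, add_zero] at hht
    simpa using (WithBot.coe_le_coe.2 (hht.trans hdim))
  · have hmax : (p.comap C).IsMaximal := by rw [hp]; infer_instance
    obtain ⟨y, hy, hpy⟩ := Polynomial.exists_monic_span_sup_map_eq R p hmax (by rwa [hp])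
    rw [hp] at hpy
    have hyp : y ∈ p := by
      rw [hpy]
      exact le_sup_right (a := Ideal.map C _) (Ideal.mem_span_singleton_self y)
    refine ⟨(rs.map C ++ [y]).map (algebraMap R[X] (Localization.AtPrime p)),
      map_algebraMap_mem_maximalIdeal ?_, IsWeaklyRegular.of_isLocalization _ p.primeCompl ?_, ?_⟩
    · intro x hx
      rcases List.mem_append.1 hx with hx | hx
      · exact hmem x hx
      · rw [List.mem_singleton.1 hx]
        exact hyp
    · rw [isWeaklyRegular_append_iff, isWeaklyRegular_singleton_iff]
      refine ⟨hreg', ?_⟩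
      rw [smul_eq_mul, Ideal.mul_top, ← Ideal.map_ofList]
      exact isSMulRegular_quotient_map_C_of_monic _ hy
    · rw [IsLocalization.AtPrime.ringKrullDim_eq_height p]
      have h1 : (p.map (Ideal.Quotient.mk ((maximalIdeal R).map (algebraMap R R[X])))) =
          Ideal.span {Ideal.Quotient.mk _ y} := by
        conv_lhs => rw [hpy]
        rw [Ideal.map_sup, Ideal.map_span, Set.image_singleton, sup_eq_right]
        exact (Ideal.map_eq_bot_iff_le_ker _).2 (by rw [Ideal.mk_ker]; rfl) |>.trans_le bot_le
      rw [h1] at hht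
      have h2 := Ideal.height_span_singleton_le_one
        (x := Ideal.Quotient.mk ((maximalIdeal R).map (algebraMap R R[X])) y) fun hu => by
          rw [← Ideal.span_singleton_eq_top, ← h1] at hu
          exact (Ideal.isPrime_map_quotientMk_of_isPrime
            (Ideal.map_le_iff_le_comap.2 hp.ge)).ne_top hu
      simpa using (WithBot.coe_le_coe.2 (hht.trans (add_le_add hdim h2)))

-- Localizing the base at `q = p ∩ R` turns `R[X]_p` into a localization of `R_q[X]` at a prime over
-- the maximal ideal, which is the local case.
open Polynomial in
lemma IsCohenMacaulay.polynomial {R : Type*} [CommRing R] [IsNoetherianRing R]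
    (h : IsCohenMacaulay R) : IsCohenMacaulay R[X] := by
  intro p hp
  let q := p.comap C
  let S := (Localization.AtPrime q)[X]
  let pc := Submonoid.map Polynomial.C.toMonoidHom q.primeCompl
  let : Algebra R[X] S := algebra R (Localization.AtPrime q)
  have : IsLocalization pc S := Polynomial.isLocalization _ _
  let pS := p.map (algebraMap R[X] S)
  have disj : Disjoint (pc : Set R[X]) (p : Set R[X]) := by
    simpa [pc, q] using! Set.disjoint_image_left.mpr
      (Set.disjoint_compl_left_iff_subset.mpr (fun _ a ↦ a))
  have : pS.IsPrime := IsLocalization.isPrime_of_isPrime_disjoint pc _ _ ‹_› disj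
  have : IsLocalization.AtPrime (Localization.AtPrime pS) p := by
    convert IsLocalization.isLocalization_isLocalization_atPrime_isLocalization pc
      (Localization.AtPrime pS) pS
    exact (IsLocalization.under_map_of_isPrime_disjoint pc _ ‹_› disj).symm
  have eq : Ideal.comap C pS = maximalIdeal (Localization.AtPrime q) := by
    rw [← IsLocalization.map_under q.primeCompl _ (Ideal.comap C pS),
      ← IsLocalization.map_under q.primeCompl _ (maximalIdeal (Localization.AtPrime q))]
    simp only [Ideal.comap_comap, S, pS]
    rw [← Polynomial.algebraMap_eq (R := Localization.AtPrime q),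
      ← IsScalarTower.algebraMap_eq R (Localization.AtPrime q) (Localization.AtPrime q)[X],
      IsScalarTower.algebraMap_eq R R[X] (Localization.AtPrime q)[X], ← Ideal.comap_comap,
      ← Ideal.under_def R[X], IsLocalization.under_map_of_isPrime_disjoint pc _ ‹_› disj]
    simp [q, IsLocalization.AtPrime.under_maximalIdeal (Localization.AtPrime q) q]
  have := isCohenMacaulayLocal_localization_polynomial (h q) pS eq
  exact this.of_ringEquiv (IsLocalization.algEquiv p.primeCompl
    (Localization.AtPrime pS) (Localization.AtPrime p)).toRingEquiv

lemma IsCohenMacaulay.mvPolynomial {R : Type*} [CommRing R] [IsNoetherianRing R]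
    (h : IsCohenMacaulay R) (ι : Type*) [Finite ι] : IsCohenMacaulay (MvPolynomial ι R) := by
  induction ι using Finite.induction_empty_option with
  | of_equiv e H => exact H.of_ringEquiv (MvPolynomial.renameEquiv _ e).toRingEquiv
  | h_empty => exact h.of_ringEquiv (MvPolynomial.isEmptyRingEquiv R _).symm
  | h_option IH =>
    exact IH.polynomial.of_ringEquiv (MvPolynomial.optionEquivLeft _ _).toRingEquiv.symm

/-- Flatness carries the regular sequence upstairs, and its length still suffices: by
quasi-finiteness there are no strict inclusions between primes in a fibre, so the height of `p` is
at most that of its contraction. -/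
lemma IsCohenMacaulay.of_etale {R S : Type*} [CommRing R] [CommRing S] [Algebra R S]
    [IsNoetherianRing R] [Algebra.Etale R S] (h : IsCohenMacaulay R) : IsCohenMacaulay S := by
  intro p hp
  have : IsNoetherianRing S := Algebra.FiniteType.isNoetherianRing R S
  have : Module.Flat R S := Algebra.Smooth.flat_of_isNoetherianRing R S
  obtain ⟨rs, hrs, hreg, hdim⟩ := h (p.under R)
  have hht := Ideal.height_le_height_add_of_liesOver (p.under R) p
  have h0 : (p.map (Ideal.Quotient.mk ((p.under R).map (algebraMap R S)))).height = 0 := by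
    have hle : (p.under R).map (algebraMap R S) ≤ p := Ideal.map_comap_le
    have := Ideal.isPrime_map_quotientMk_of_isPrime hle
    refine le_antisymm (Ideal.height_le_iff.2 fun q hq hqp => ?_) bot_le
    have hq' : q.comap (Ideal.Quotient.mk _) = p := by
      have h1 : q.comap (Ideal.Quotient.mk _) ≤ p := by
        refine (Ideal.comap_mono hqp.le).trans_eq ?_
        rw [Ideal.comap_map_of_surjective' _ Ideal.Quotient.mk_surjective, Ideal.mk_ker,
          sup_eq_left.2 hle]
      refine Algebra.QuasiFinite.eq_of_le_of_under_eq (R := R) _ _ h1 (le_antisymm ?_ ?_)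
      · exact Ideal.comap_mono h1
      · intro x hx
        change Ideal.Quotient.mk _ (algebraMap R S x) ∈ q
        rw [Ideal.Quotient.eq_zero_iff_mem.2 (Ideal.mem_map_of_mem _ hx)]
        exact q.zero_mem
    refine absurd hqp.not_ge (not_not.2 ?_)
    exact Ideal.map_le_iff_le_comap.2 hq'.ge
  rw [h0, add_zero] at hht
  let φ := Localization.localRingHom (p.under R) p (algebraMap R S) rfl
  have hφ : φ.Flat := RingHom.Flat.localRingHom (RingHom.flat_algebraMap_iff.2 ‹_›) _ _ _
  let := φ.toAlgebra
  have : Module.Flat (Localization.AtPrime (p.under R)) (Localization.AtPrime p) := hφ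
  refine ⟨rs.map φ, ?_, hreg.of_flat (S := Localization.AtPrime p), ?_⟩
  · intro x hx
    obtain ⟨y, hy, rfl⟩ := List.mem_map.1 hx
    exact map_nonunit φ y (hrs y hy)
  · rw [IsLocalization.AtPrime.ringKrullDim_eq_height p, List.length_map]
    rw [IsLocalization.AtPrime.ringKrullDim_eq_height (p.under R)] at hdim
    exact (WithBot.coe_le_coe.2 hht).trans hdim

/-- If all `Ext^i(k, M)` with `i < n` vanish, the residue field does not embed into the quotient of
`M` by a regular sequence of length less than `n`. -/
lemma subsingleton_linearMap_of_isWeaklyRegular {R : Type u} [CommRing R]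
    (N : ModuleCat.{u} R) (rs : List R) (n : ℕ) (hn : rs.length < n) (M : ModuleCat.{u} R)
    (hreg : IsWeaklyRegular M rs) (hext : ∀ i < n, Subsingleton (Ext N M i)) :
    Subsingleton (N →ₗ[R] M ⧸ (Ideal.ofList rs • ⊤ : Submodule R M)) := by
  induction rs generalizing M n with
  | nil =>
    have := hext 0 hn
    have : Subsingleton (N →ₗ[R] M) :=
      (Ext.addEquiv₀.trans ModuleCat.homAddEquiv).symm.subsingleton
    have e : (M ⧸ (Ideal.ofList ([] : List R) • ⊤ : Submodule R M)) ≃ₗ[R] M :=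
      Submodule.quotEquivOfEqBot (Ideal.ofList ([] : List R) • ⊤ : Submodule R M)
        (by rw [Ideal.ofList_nil, Submodule.bot_smul])
    refine ⟨fun f g => LinearMap.ext fun x => e.injective ?_⟩
    exact LinearMap.congr_fun
      (Subsingleton.elim (e.toLinearMap ∘ₗ f) (e.toLinearMap ∘ₗ g)) x
  | cons r rs ih =>
    rw [isWeaklyRegular_cons_iff] at hreg
    obtain ⟨n, rfl⟩ : ∃ m, n = m + 1 := ⟨n - 1, by simp at hn; omega⟩
    have := ih n (by simpa using hn) (ModuleCat.of R (QuotSMulTop r M)) hreg.2 fun i hi => by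
      have zero1 := AddCommGrpCat.isZero_of_iff_subsingleton.mpr (hext i (by omega))
      have zero2 := AddCommGrpCat.isZero_of_iff_subsingleton.mpr (hext (i + 1) (by omega))
      -- In the long exact sequence of `0 → M → M → M / rM → 0`, `Ext^i(N, M / rM)` lies between
      -- `Ext^i(N, M)` and `Ext^(i+1)(N, M)`; each element of the sequence costs one degree.
      exact AddCommGrpCat.subsingleton_of_isZero <| ShortComplex.Exact.isZero_of_both_zeros
        ((Ext.covariant_sequence_exact₃' N hreg.1.smulShortComplex_shortExact) i (i + 1) rfl)
        (zero1.eq_zero_of_src _) (zero2.eq_zero_of_tgt _)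
    let e := Submodule.quotOfListConsSMulTopEquivQuotSMulTopInner M r rs
    refine ⟨fun f g => LinearMap.ext fun x => e.injective ?_⟩
    exact LinearMap.congr_fun
      (Subsingleton.elim (e.toLinearMap ∘ₗ f) (e.toLinearMap ∘ₗ g)) x

/-- In a Cohen–Macaulay local ring, if the quotient by a regular sequence has depth zero, then the
sequence has length at least the dimension. -/
lemma IsCohenMacaulayLocal.ringKrullDim_le_length {R : Type u} [CommRing R] [IsLocalRing R]
    [IsNoetherianRing R] (h : IsCohenMacaulayLocal R) {rs : List R}
    (hreg : IsWeaklyRegular R rs) {x : R} (hx : x ∉ Ideal.ofList rs)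
    (hmx : ∀ y ∈ maximalIdeal R, y * x ∈ Ideal.ofList rs) :
    ringKrullDim R ≤ rs.length := by
  obtain ⟨ss, hss, hssreg, hdim⟩ := h
  by_contra hlt
  have hlen : rs.length < ss.length := by
    by_contra hle
    exact hlt (hdim.trans (by exact_mod_cast not_lt.1 hle))
  have hlt' : maximalIdeal R • (⊤ : Submodule R (ModuleCat.of R R)) < ⊤ := by
    rw [smul_eq_mul, Ideal.mul_top]
    exact lt_top_iff_ne_top.2 Ideal.IsPrime.ne_top'
  have hext := ModuleCat.subsingleton_ext_of_exists_isRegular (maximalIdeal R)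
    (ModuleCat.of R (R ⧸ maximalIdeal R)) (by
      rw [Module.support_eq_zeroLocus, Ideal.annihilator_quotient]) (ModuleCat.of R R) hlt' ss hss
    ((isRegular_iff_isWeaklyRegular_of_subset_maximalIdeal hss).2 hssreg)
  have := subsingleton_linearMap_of_isWeaklyRegular (ModuleCat.of R (R ⧸ maximalIdeal R)) rs _ hlen
    (ModuleCat.of R R) hreg hext
  -- The class of `x` is killed by the maximal ideal, so `1 ↦ x` descends to a map from the residue
  -- field, which must vanish.
  let g : R →ₗ[R] R ⧸ (Ideal.ofList rs • ⊤ : Submodule R R) :=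
    LinearMap.toSpanSingleton R _ (Submodule.Quotient.mk x)
  have hg : maximalIdeal R ≤ LinearMap.ker g := fun y hy => by
    rw [LinearMap.mem_ker, LinearMap.toSpanSingleton_apply, ← Submodule.Quotient.mk_smul,
      Submodule.Quotient.mk_eq_zero]
    simpa using hmx y hy
  have h0 : g 1 = 0 := LinearMap.congr_fun
    (Subsingleton.elim (Submodule.liftQ _ g hg : (R ⧸ maximalIdeal R) →ₗ[R] _) 0)
    (Submodule.Quotient.mk 1)
  rw [LinearMap.toSpanSingleton_apply, one_smul, Submodule.Quotient.mk_eq_zero] at h0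
  exact hx (by simpa using h0)

end CohenMacaulay

variable {X : Scheme.{u}}

attribute [local instance] Abelian.hasFiniteBiproducts

/-! ### Sections of the Mayer–Vietoris terms and local criteria for exactness. -/

section Sheaves

/-- Exactness of a short complex of `𝒪_X`-modules may be checked on sections over a basis. -/
lemma exact_of_forall_mem_basis (S : ShortComplex X.Modules) (B : Set X.Opens)
    (hB : ∀ (U : X.Opens) (x : X), x ∈ U → ∃ W ∈ B, x ∈ W ∧ W ≤ U)
    (h : ∀ W ∈ B, ∀ s : Γ(S.X₂, W), S.g.app W s = 0 → ∃ t : Γ(S.X₁, W), S.f.app W t = s) :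
    S.Exact := by
  -- This form avoids computing sections of the cokernel: it is enough that the composite kills
  -- sections locally and that the cokernel is a sheaf.
  rw [ShortComplex.exact_iff_kernel_ι_comp_cokernel_π_zero]
  apply Scheme.Modules.hom_ext
  intro U
  ext s
  have hloc : ∀ W ∈ B, ∀ s : Γ(kernel S.g, W),
      (kernel.ι S.g ≫ cokernel.π S.f).app W s = 0 := by
    intro W hW s
    obtain ⟨t, ht⟩ := h W hW ((kernel.ι S.g).app W s) (by
      have := congrArg (fun φ => Scheme.Modules.Hom.app φ W) (kernel.condition S.g)
      exact congr($this s))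
    have := congrArg (fun φ => Scheme.Modules.Hom.app φ W) (cokernel.condition S.f)
    have h2 := congr($this t)
    change (cokernel.π S.f).app W ((kernel.ι S.g).app W s) = 0
    rw [← ht]
    exact h2
  let F : TopCat.Sheaf Ab X := ⟨(cokernel S.f).presheaf, (cokernel S.f).isSheaf⟩
  refine TopCat.Sheaf.eq_of_locally_eq' F (fun W : {W : B // W.1 ≤ U} => W.1.1) U
    (fun W => homOfLE W.2) ?_ _ _ ?_
  · intro x hx
    obtain ⟨W, hW, hxW, hWU⟩ := hB U x hx
    exact TopologicalSpace.Opens.mem_iSup.2 ⟨⟨⟨W, hW⟩, hWU⟩, hxW⟩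
  · intro W
    have h1 := hloc W.1.1 W.1.2 ((kernel S.g).presheaf.map (homOfLE W.2).op s)
    have h2 := congr($((kernel.ι S.g ≫ cokernel.π S.f).mapPresheaf.naturality (homOfLE W.2).op) s)
    refine (h2.symm.trans h1).trans ?_
    exact (map_zero ((cokernel S.f).presheaf.map (homOfLE W.2).op).hom).symm

/-- Restriction of functions from `X` to the closed subscheme defined by `I`. -/
def restrictSections (I : X.IdealSheafData) (W : X.Opens) : Γ(X, W) →+ Γ(structureModule I, W) :=
  (I.subschemeι.app W).hom.toAddMonoidHom

lemma restrictSections_surjective (I : X.IdealSheafData) (W : X.affineOpens) :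
    Function.Surjective (restrictSections I W.1) :=
  I.subschemeι_app_surjective W

lemma restrictSections_eq_zero_iff (I : X.IdealSheafData) (W : X.affineOpens) (a : Γ(X, W.1)) :
    restrictSections I W.1 a = 0 ↔ a ∈ I.ideal W := by
  rw [← I.ker_subschemeι_app W]
  rfl

lemma restrict_app_restrictSections {I J : X.IdealSheafData} (h : I ≤ J) (W : X.Opens)
    (a : Γ(X, W)) : (restrict h).app W (restrictSections I W a) = restrictSections J W a := by
  rw [restrict_app]
  have h1 : I.subschemeι.app W ≫ (Scheme.IdealSheafData.inclusion h).appLE (I.subschemeι ⁻¹ᵁ W)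
      (J.subschemeι ⁻¹ᵁ W)
        (by rw [← Scheme.Hom.comp_preimage, Scheme.IdealSheafData.inclusion_subschemeι]) =
      J.subschemeι.app W := by
    rw [Scheme.Hom.app_eq_appLE, Scheme.Hom.appLE_comp_appLE, Scheme.Hom.app_eq_appLE]
    simp only [Scheme.IdealSheafData.inclusion_subschemeι]
  exact congr($h1 a)

lemma app_sum {M N : X.Modules} {ι : Type*} (s : Finset ι) (f : ι → (M ⟶ N)) (W : X.Opens)
    (x : Γ(M, W)) : (∑ i ∈ s, f i).app W x = ∑ i ∈ s, (f i).app W x := by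
  let F : (M ⟶ N) →+ Γ(N, W) :=
    { toFun f := f.app W x
      map_zero' := rfl
      map_add' _ _ := rfl }
  exact map_sum F f s

lemma app_zsmul {M N : X.Modules} (n : ℤ) (f : M ⟶ N) (W : X.Opens)
    (x : Γ(M, W)) : (n • f).app W x = n • f.app W x := by
  let F : (M ⟶ N) →+ Γ(N, W) :=
    { toFun f := f.app W x
      map_zero' := rfl
      map_add' _ _ := rfl }
  exact map_zsmul F n f

variable {r : ℕ} (D : Fin r → X.IdealSheafData)

lemma sheafTerm_section_ext {p : ℕ} {W : X.Opens} {s t : Γ(sheafTerm D p, W)}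
    (h : ∀ φ, (proj D p φ).app W s = (proj D p φ).app W t) : s = t := by
  let Y := fun φ : Fin (p + 1) ↪o Fin r => structureModule (interIdeal D φ)
  have key : ∀ s : Γ(sheafTerm D p, W),
      s = ∑ φ, (biproduct.ι Y φ).app W ((proj D p φ).app W s) := by
    intro s
    have h1 := congrArg (fun ψ => Scheme.Modules.Hom.app ψ W s) (biproduct.total (f := Y))
    exact h1.symm.trans (app_sum _ _ _ _)
  refine (key s).trans (Eq.trans ?_ (key t).symm)
  exact Finset.sum_congr rfl fun φ _ => congrArg ((biproduct.ι Y φ).app W) (h φ)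

lemma exists_sheafTerm_section {p : ℕ} {W : X.Opens}
    (s : ∀ φ : Fin (p + 1) ↪o Fin r, Γ(structureModule (interIdeal D φ), W)) :
    ∃ t : Γ(sheafTerm D p, W), ∀ φ, (proj D p φ).app W t = s φ := by
  let Y := fun φ : Fin (p + 1) ↪o Fin r => structureModule (interIdeal D φ)
  refine ⟨∑ φ, (biproduct.ι Y φ).app W (s φ), fun φ => ?_⟩
  refine (map_sum ((proj D p φ).app W).hom _ _).trans ?_
  refine (Finset.sum_eq_single φ (fun ψ _ hψ => ?_) (by simp)).trans ?_
  · exact congrArg (fun χ => Scheme.Modules.Hom.app χ W (s ψ)) (biproduct.ι_π_ne Y hψ)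
  · exact congrArg (fun χ => Scheme.Modules.Hom.app χ W (s φ)) (biproduct.ι_π_self Y φ)

lemma proj_app_diff_app {p : ℕ} (φ : Fin (p + 2) ↪o Fin r) (W : X.Opens)
    (s : Γ(sheafTerm D p, W)) (a : (Fin (p + 1) ↪o Fin r) → Γ(X, W))
    (h : ∀ ψ, (proj D p ψ).app W s = restrictSections _ W (a ψ)) :
    (proj D (p + 1) φ).app W ((diff D p).app W s) =
      restrictSections (interIdeal D φ) W (∑ j : Fin (p + 2), (-1) ^ (j : ℕ) * a (face φ j)) := by
  have h1 := congrArg (fun ψ => Scheme.Modules.Hom.app ψ W s) (diff_proj D p φ)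
  refine h1.trans ?_
  rw [app_sum, map_sum]
  refine Finset.sum_congr rfl fun j _ => ?_
  rw [app_zsmul]
  have h2 : (proj D p (face φ j) ≫ restrict (interIdeal_face_le D φ j)).app W s =
      restrictSections _ W (a (face φ j)) := by
    rw [← restrict_app_restrictSections (interIdeal_face_le D φ j), ← h]
    rfl
  rw [h2, ← map_zsmul]
  congr 1
  simp

lemma proj_app_augmentation_app (φ : Fin 1 ↪o Fin r) (W : X.Opens) (a : Γ(X, W)) :
    (proj D 0 φ).app W ((augmentation D).app W (restrictSections _ W a)) =
      restrictSections (interIdeal D φ) W a := by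
  have h1 := congrArg (fun ψ => Scheme.Modules.Hom.app ψ W (restrictSections _ W a))
    (augmentation_proj D φ)
  exact h1.trans (restrict_app_restrictSections _ _ _)

end Sheaves

/-! ### From heights of primes to regular sequences. -/

section RegularSequences

open IsLocalRing RingTheory.Sequence

/-- In a Cohen–Macaulay ring, an element `g` is regular modulo a regular sequence `rs` if the primes
containing `g` and `rs` have height larger than the length of `rs`. -/
lemma IsCohenMacaulay.mem_ofList_of_mul_mem {R : Type u} [CommRing R] [IsNoetherianRing R]
    (h : IsCohenMacaulay R) {rs : List R} (hreg : IsWeaklyRegular R rs) {g : R}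
    (hg : ∀ (p : Ideal R) [p.IsPrime], Ideal.ofList rs ≤ p → g ∈ p → (rs.length : ℕ∞) < p.height)
    {x : R} (hx : g * x ∈ Ideal.ofList rs) : x ∈ Ideal.ofList rs := by
  by_contra hx'
  obtain ⟨p, hp, hle⟩ := exists_le_isAssociatedPrime_of_isNoetherianRing (R := R)
    (Ideal.Quotient.mk (Ideal.ofList rs) x) (by rwa [Ne, Ideal.Quotient.eq_zero_iff_mem])
  obtain ⟨hp, y, hpy⟩ := isAssociatedPrime_iff.1 hp
  obtain ⟨y, rfl⟩ := Ideal.Quotient.mk_surjective y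
  have hmem : ∀ a z : R, a ∈ (⊥ : Submodule R (R ⧸ Ideal.ofList rs)).colon
      {Ideal.Quotient.mk (Ideal.ofList rs) z} ↔ a * z ∈ Ideal.ofList rs := by
    intro a z
    rw [Submodule.mem_colon_singleton, Submodule.mem_bot, ← Ideal.Quotient.eq_zero_iff_mem]
    rfl
  have hpy' : ∀ a, a ∈ p ↔ a * y ∈ Ideal.ofList rs := fun a => by rw [← hmem, ← hpy]
  have hgp : g ∈ p := hle ((hmem g x).2 hx)
  have hrsp : Ideal.ofList rs ≤ p := fun a ha => (hpy' a).2 (Ideal.mul_mem_right _ _ ha)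
  have h1 := (h p).ringKrullDim_le_length (hreg.of_isLocalization (Localization.AtPrime p)
    p.primeCompl) (x := algebraMap R _ y)
  rw [← Ideal.map_ofList, List.length_map, IsLocalization.AtPrime.ringKrullDim_eq_height p] at h1
  refine (hg p hrsp hgp).not_ge ?_
  have h2 : (p.height : WithBot ℕ∞) ≤ ((rs.length : ℕ∞) : WithBot ℕ∞) := by
    refine h1 ?_ ?_
    · rw [IsLocalization.algebraMap_mem_map_algebraMap_iff p.primeCompl]
      rintro ⟨m, hm, hmy⟩
      exact hm ((hpy' m).2 hmy)
    · rw [← Localization.AtPrime.map_eq_maximalIdeal]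
      intro z hz
      have hle' : p.map (algebraMap R (Localization.AtPrime p)) ≤
          ((Ideal.ofList rs).map (algebraMap R (Localization.AtPrime p))).colon
            {algebraMap R (Localization.AtPrime p) y} := by
        refine Ideal.map_le_iff_le_comap.2 fun a ha => ?_
        rw [Ideal.mem_comap, Submodule.mem_colon_singleton, smul_eq_mul, ← map_mul]
        exact Ideal.mem_map_of_mem _ ((hpy' a).1 ha)
      exact Submodule.mem_colon_singleton.1 (hle' hz)
  exact_mod_cast h2

lemma isPermutablyRegular_of_forall_isWeaklyRegular {R : Type*} [CommRing R] {r : ℕ} {f : Fin r → R}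
    (h : ∀ (l : List (Fin r)) (i : Fin r), (i :: l).Nodup → ∀ x,
      f i * x ∈ Ideal.ofList (l.map f) → x ∈ Ideal.ofList (l.map f)) :
    IsPermutablyRegular ⊥ f Finset.univ := by
  intro S _ i _ hi x hx
  have hS : adjoinIdeal ⊥ f S = Ideal.ofList (S.toList.map f) := by
    rw [adjoinIdeal, bot_sup_eq, Ideal.ofList]
    congr 1
    ext y
    simp
  rw [hS] at hx ⊢
  exact h _ i (List.nodup_cons.2 ⟨by simpa using hi, S.nodup_toList⟩) x hx

/-- Elements of a Cohen–Macaulay ring form a regular sequence in any order if the primes containing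
`n` of them have height at least `n`. -/
lemma IsCohenMacaulay.isPermutablyRegular {R : Type u} [CommRing R] [IsNoetherianRing R]
    (h : IsCohenMacaulay R) {r : ℕ} {f : Fin r → R}
    (hf : ∀ (p : Ideal R) [p.IsPrime] (S : Finset (Fin r)), (∀ i ∈ S, f i ∈ p) →
      (S.card : ℕ∞) ≤ p.height) :
    IsPermutablyRegular ⊥ f Finset.univ := by
  have key : ∀ (l : List (Fin r)) (i : Fin r), (i :: l).Nodup → IsWeaklyRegular R (l.map f) →
      ∀ x, f i * x ∈ Ideal.ofList (l.map f) → x ∈ Ideal.ofList (l.map f) := by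
    intro l i hl hreg x hx
    refine h.mem_ofList_of_mul_mem hreg (fun p _ hle hip => ?_) hx
    have := hf p (i :: l).toFinset fun j hj => by
      rw [List.mem_toFinset, List.mem_cons] at hj
      rcases hj with rfl | hj
      · exact hip
      · exact hle (Ideal.subset_span (List.mem_map_of_mem hj))
    rw [List.toFinset_card_of_nodup hl, List.length_cons] at this
    rw [List.length_map]
    refine lt_of_lt_of_le ?_ this
    exact_mod_cast Nat.lt_succ_self _
  have hreg : ∀ l : List (Fin r), l.Nodup → IsWeaklyRegular R (l.map f) := by
    intro l
    induction l using List.reverseRecOn with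
    | nil => intro _; exact IsWeaklyRegular.nil _ _
    | append_singleton l i ih =>
      intro hl
      have hl' : (i :: l).Nodup := (List.perm_append_singleton i l).nodup_iff.1 hl
      have hreg := ih hl'.of_cons
      rw [List.map_append, isWeaklyRegular_append_iff]
      refine ⟨hreg, (isWeaklyRegular_singleton_iff _ _).2 ?_⟩
      rw [isSMulRegular_quotient_iff_mem_of_smul_mem]
      intro x hx
      rw [smul_eq_mul, Ideal.mul_top] at hx ⊢
      exact key l i hl' hreg x hx
  exact isPermutablyRegular_of_forall_isWeaklyRegular fun l i hl => key l i hl (hreg l hl.of_cons)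

end RegularSequences

/-! ### Smooth schemes are Cohen–Macaulay; local equations of the divisors. -/

section Schemes

open IsLocalRing

lemma isCohenMacaulayLocal_stalk {U : X.Opens} (hU : IsAffineOpen U)
    (h : IsCohenMacaulay Γ(X, U)) {x : X} (hx : x ∈ U) :
    IsCohenMacaulayLocal (X.presheaf.stalk x) := by
  let := X.presheaf.algebra_section_stalk ⟨x, hx⟩
  have := hU.isLocalization_stalk ⟨x, hx⟩
  exact h.localization (hU.primeIdealOf ⟨x, hx⟩).asIdeal _

lemma isCohenMacaulay_of_stalk {U : X.Opens} (hU : IsAffineOpen U)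
    (h : ∀ x : X, IsCohenMacaulayLocal (X.presheaf.stalk x)) : IsCohenMacaulay Γ(X, U) := by
  intro p hp
  have hy : hU.fromSpec ⟨p, hp⟩ ∈ U := hU.range_fromSpec.le ⟨_, rfl⟩
  let : Algebra Γ(X, U) (X.presheaf.stalk (hU.fromSpec ⟨p, hp⟩)) :=
    X.presheaf.algebra_section_stalk ⟨_, hy⟩
  have : IsLocalization.AtPrime (X.presheaf.stalk (hU.fromSpec ⟨p, hp⟩)) p :=
    hU.isLocalization_stalk' ⟨p, hp⟩ hy
  exact (h _).of_ringEquiv (IsLocalization.algEquiv p.primeCompl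
    (X.presheaf.stalk (hU.fromSpec ⟨p, hp⟩)) (Localization.AtPrime p)).toRingEquiv

/-- Each point has a chart étale over a polynomial ring over `k`. The chart need not be related to
`W`, so the property is transferred through stalks. -/
lemma isCohenMacaulay_of_smooth (k : Type u) [Field k] (π : X ⟶ Spec (CommRingCat.of k))
    [Smooth π] {W : X.Opens} (hW : IsAffineOpen W) : IsCohenMacaulay Γ(X, W) := by
  refine isCohenMacaulay_of_stalk hW fun x => ?_
  obtain ⟨U, hU, V, hV, hxV, e, hstd⟩ := Smooth.exists_isStandardSmooth π x
  refine isCohenMacaulayLocal_stalk hV ?_ hxV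
  obtain ⟨n, g, -, hg⟩ := hstd.exists_etale_mvPolynomial
  have hUtop : U = ⊤ := by
    ext y
    simp only [TopologicalSpace.Opens.coe_top, Set.mem_univ, iff_true]
    rw [Subsingleton.elim y (π x)]
    exact e hxV
  have hUk : IsCohenMacaulay Γ(Spec (CommRingCat.of k), U) := by
    subst hUtop
    exact (isCohenMacaulay_of_field k).of_ringEquiv
      (Scheme.ΓSpecIso (CommRingCat.of k)).symm.commRingCatIsoToRingEquiv
  have : IsNoetherianRing Γ(Spec (CommRingCat.of k), U) :=
    IsLocallyNoetherian.component_noetherian ⟨U, hU⟩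
  algebraize [g]
  exact (hUk.mvPolynomial (Fin n)).of_etale

/-- A prime containing `f i` for `i ∈ S` is a point of the intersection of those `D i`, which is
thus nonempty. The height of the prime is the coheight of that point, hence at least the codimension
`S.card`. -/
lemma isPermutablyRegular_of_codim (k : Type u) [Field k] (π : X ⟶ Spec (CommRingCat.of k))
    [Smooth π] {r : ℕ} (D : Fin r → X.IdealSheafData)
    (hcodim : ∀ S : Finset (Fin r),
      (⋂ i ∈ S, ((D i).support : Set X)) = ∅ ∨
        codim (⋂ i ∈ S, ((D i).support : Set X)) = S.card)
    (W : X.affineOpens) (f : Fin r → Γ(X, W.1)) (hf : ∀ i, (D i).ideal W = Ideal.span {f i}) :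
    IsPermutablyRegular ⊥ f Finset.univ := by
  have : IsLocallyNoetherian X := LocallyOfFiniteType.isLocallyNoetherian π
  have : IsNoetherianRing Γ(X, W.1) := IsLocallyNoetherian.component_noetherian W
  refine (isCohenMacaulay_of_smooth k π W.2).isPermutablyRegular fun p hp S hS => ?_
  set x : X := W.2.fromSpec ⟨p, hp⟩ with hx
  have hxW : x ∈ W.1 := W.2.range_fromSpec.le ⟨_, rfl⟩
  let : Algebra Γ(X, W.1) (X.presheaf.stalk x) := X.presheaf.algebra_section_stalk ⟨x, hxW⟩
  have : IsLocalization.AtPrime (X.presheaf.stalk x) p := W.2.isLocalization_stalk' ⟨p, hp⟩ hxW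
  have hht : p.height = Order.coheight x := by
    have h1 := ringKrullDim_stalk_eq_coheight x
    rw [IsLocalization.AtPrime.ringKrullDim_eq_height p (X.presheaf.stalk x)] at h1
    exact_mod_cast h1
  have hxS : x ∈ ⋂ i ∈ S, ((D i).support : Set X) := by
    simp only [Set.mem_iInter]
    intro i hi
    change x ∈ (D i).support
    rw [Scheme.IdealSheafData.mem_support_iff_of_mem hxW, hf, Scheme.zeroLocus_span,
      Scheme.mem_zeroLocus_iff]
    rintro _ rfl hxf
    rw [Scheme.mem_basicOpen _ _ _ hxW] at hxf
    exact (IsLocalization.AtPrime.isUnit_to_map_iff (X.presheaf.stalk x) p (f i)).1 hxf (hS i hi)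
  rcases hcodim S with h | h
  · rw [h] at hxS
    exact hxS.elim
  · rw [← h, hht]
    exact iInf₂_le x hxS

lemma ideal_interIdeal {r : ℕ} (D : Fin r → X.IdealSheafData) {W : X.affineOpens}
    {f : Fin r → Γ(X, W.1)} (hf : ∀ i, (D i).ideal W = Ideal.span {f i}) {p : ℕ}
    (φ : Fin (p + 1) ↪o Fin r) :
    (interIdeal D φ).ideal W = Ideal.span (Set.range (f ∘ φ)) := by
  rw [interIdeal, Scheme.IdealSheafData.ideal_iSup, iSup_apply, ← Set.iUnion_singleton_eq_range,
    Ideal.span_iUnion]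
  simp only [hf, Function.comp_apply]

lemma exists_affineOpens_principal {r : ℕ} (D : Fin r → X.IdealSheafData)
    (hD : ∀ i, IsEffectiveCartierDivisor (D i)) (U : X.Opens) (x : X) (hx : x ∈ U) :
    ∃ W : X.affineOpens, (∃ f : Fin r → Γ(X, W.1), ∀ i, (D i).ideal W = Ideal.span {f i}) ∧
      x ∈ W.1 ∧ W.1 ≤ U := by
  choose V hV f _ hf using fun i => hD i x
  obtain ⟨W, ⟨hW, hxW, hle⟩⟩ : ∃ W : X.affineOpens, x ∈ W.1 ∧ W.1 ≤ U ∧ ∀ i, W.1 ≤ (V i).1 := by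
    have hx' : x ∈ U ⊓ ⨅ i, (V i).1 := by
      refine ⟨hx, ?_⟩
      rw [SetLike.mem_coe, ← SetLike.mem_coe, TopologicalSpace.Opens.coe_iInf]
      exact Set.mem_iInter.2 hV
    obtain ⟨_, ⟨W, hW, rfl⟩, hxW, hWU⟩ := X.isBasis_affineOpens.exists_subset_of_mem_open hx'
      (U ⊓ ⨅ i, (V i).1).isOpen
    have hWU' : W ≤ U ⊓ ⨅ i, (V i).1 := hWU
    exact ⟨⟨W, hW⟩, hxW, hWU'.trans inf_le_left, fun i =>
      hWU'.trans (inf_le_right.trans (iInf_le _ i))⟩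
  refine ⟨W, ⟨fun i => X.presheaf.map (homOfLE (hle i)).op (f i), fun i => ?_⟩, hW, hxW⟩
  rw [← (D i).map_ideal (hle i), hf, Ideal.map_span, Set.image_singleton]
  rfl

end Schemes

/-! ### Exactness over affine opens with principal ideals, and assembly. -/

section Exactness

variable {r : ℕ} {D : Fin r → X.IdealSheafData} {W : X.affineOpens}
  {f : Fin r → Γ(X, W.1)}

/-- Injectivity is formal: the ideal of the union is by definition the intersection of the ideals.
-/
lemma eq_zero_of_augmentation_app_eq_zero (s : Γ(structureModule (unionIdeal D), W.1))
    (hs : (augmentation D).app W.1 s = 0) : s = 0 := by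
  obtain ⟨a, rfl⟩ := restrictSections_surjective _ W s
  rw [restrictSections_eq_zero_iff, unionIdeal, Scheme.IdealSheafData.ideal_iInf, iInf_apply,
    Ideal.mem_iInf]
  intro i
  let φ : Fin 1 ↪o Fin r := OrderEmbedding.ofStrictMono (fun _ => i) (Subsingleton.strictMono _)
  have h1 := proj_app_augmentation_app D φ W.1 a
  rw [hs, map_zero] at h1
  have h2 := (restrictSections_eq_zero_iff _ W a).1 h1.symm
  rw [interIdeal, Scheme.IdealSheafData.ideal_iSup, iSup_apply] at h2
  have h3 : ⨆ j, (D (φ j)).ideal W ≤ (D i).ideal W := iSup_le fun _ => le_rfl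
  exact h3 h2

lemma exists_lift_sections {p : ℕ} (s : Γ(sheafTerm D p, W.1)) :
    ∃ a : (Fin (p + 1) ↪o Fin r) → Γ(X, W.1),
      ∀ ψ, (proj D p ψ).app W.1 s = restrictSections _ W.1 (a ψ) := by
  choose a ha using fun ψ => restrictSections_surjective _ W ((proj D p ψ).app W.1 s)
  exact ⟨a, fun ψ => (ha ψ).symm⟩

lemma sum_mem_of_diff_app_eq_zero (hf : ∀ i, (D i).ideal W = Ideal.span {f i}) {p : ℕ}
    {s : Γ(sheafTerm D p, W.1)} (hs : (diff D p).app W.1 s = 0)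
    {a : (Fin (p + 1) ↪o Fin r) → Γ(X, W.1)}
    (ha : ∀ ψ, (proj D p ψ).app W.1 s = restrictSections _ W.1 (a ψ))
    (ψ : Fin (p + 2) ↪o Fin r) :
    ∑ j : Fin (p + 2), (-1) ^ (j : ℕ) * a (face ψ j) ∈ Ideal.span (Set.range (f ∘ ψ)) := by
  have h1 := proj_app_diff_app D ψ W.1 s a ha
  rw [hs, map_zero] at h1
  rw [← ideal_interIdeal D hf ψ]
  exact (restrictSections_eq_zero_iff _ W _).1 h1.symm

lemma restrictSections_eq_of_sub_mem (hf : ∀ i, (D i).ideal W = Ideal.span {f i}) {p : ℕ}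
    {φ : Fin (p + 1) ↪o Fin r} {a b : Γ(X, W.1)}
    (h : a - b ∈ Ideal.span (Set.range (f ∘ φ))) :
    restrictSections (interIdeal D φ) W.1 b = restrictSections (interIdeal D φ) W.1 a := by
  rw [← ideal_interIdeal D hf φ, ← restrictSections_eq_zero_iff, map_sub, sub_eq_zero] at h
  exact h.symm

lemma exists_augmentation_app_eq (hf : ∀ i, (D i).ideal W = Ideal.span {f i})
    (hreg : IsPermutablyRegular ⊥ f Finset.univ) (s : Γ(sheafTerm D 0, W.1))
    (hs : (diff D 0).app W.1 s = 0) : ∃ t, (augmentation D).app W.1 t = s := by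
  obtain ⟨a, ha⟩ := exists_lift_sections s
  obtain ⟨b, hb⟩ := exists_forall_sub_mem hreg a (sum_mem_of_diff_app_eq_zero hf hs ha)
  refine ⟨restrictSections _ W.1 b, sheafTerm_section_ext D fun φ => ?_⟩
  rw [proj_app_augmentation_app, ha]
  exact restrictSections_eq_of_sub_mem hf (hb φ)

lemma exists_diff_app_eq (hf : ∀ i, (D i).ideal W = Ideal.span {f i})
    (hreg : IsPermutablyRegular ⊥ f Finset.univ) {p : ℕ} (s : Γ(sheafTerm D (p + 1), W.1))
    (hs : (diff D (p + 1)).app W.1 s = 0) : ∃ t, (diff D p).app W.1 t = s := by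
  obtain ⟨a, ha⟩ := exists_lift_sections s
  obtain ⟨b, hb⟩ := exists_forall_sub_sum_mem hreg a (sum_mem_of_diff_app_eq_zero hf hs ha)
  obtain ⟨t, ht⟩ := exists_sheafTerm_section D (W := W.1) fun φ => restrictSections _ W.1 (b φ)
  refine ⟨t, sheafTerm_section_ext D fun φ => ?_⟩
  rw [proj_app_diff_app D φ W.1 t b ht, ha]
  exact restrictSections_eq_of_sub_mem hf (hb φ)

lemma mayerVietorisComplex_d_succ (p : ℕ) :
    (mayerVietorisComplex D).d (p + 1) (p + 1 + 1) = diff D p :=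
  CochainComplex.of_d _ _ p

lemma exactAt_succ_of_exact {C : Type*} [Category* C] [HasZeroMorphisms C] (K : CochainComplex C ℕ)
    (i : ℕ) {f : K.X i ⟶ K.X (i + 1)} {g : K.X (i + 1) ⟶ K.X (i + 1 + 1)} (hf : K.d i (i + 1) = f)
    (hg : K.d (i + 1) (i + 1 + 1) = g) (w : f ≫ g = 0) (h : (ShortComplex.mk f g w).Exact) :
    K.ExactAt (i + 1) := by
  subst hf hg
  rw [HomologicalComplex.exactAt_iff' _ i (i + 1) (i + 1 + 1) (by simp) (by simp)]
  exact h

lemma exactAt_zero_of_exact {C : Type*} [Category* C] [HasZeroMorphisms C] (K : CochainComplex C ℕ)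
    {f : K.X 0 ⟶ K.X 1} (hf : K.d 0 1 = f)
    (h : (ShortComplex.mk (0 : K.X 0 ⟶ K.X 0) f zero_comp).Exact) : K.ExactAt 0 := by
  subst hf
  rw [HomologicalComplex.exactAt_iff' _ 0 0 1 (by simp) (by simp)]
  -- Degree `0` has no predecessor, so its predecessor is taken to be `0` itself, and the incoming
  -- map `d 0 0` vanishes.
  have h0 : K.d 0 0 = 0 := K.shape 0 0 (by simp)
  change (ShortComplex.mk (K.d 0 0) (K.d 0 1) (K.d_comp_d 0 0 1)).Exact
  simpa only [h0] using h

lemma exactAt_zero (h : (ShortComplex.mk (0 : structureModule (unionIdeal D) ⟶ _)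
    (augmentation D) zero_comp).Exact) : (mayerVietorisComplex D).ExactAt 0 :=
  exactAt_zero_of_exact (mayerVietorisComplex D) rfl h

lemma exactAt_one (h : (ShortComplex.mk _ _ (augmentation_comp_diff D)).Exact) :
    (mayerVietorisComplex D).ExactAt 1 :=
  exactAt_succ_of_exact (mayerVietorisComplex D) 0 rfl (mayerVietorisComplex_d_succ 0) _ h

lemma exactAt_add_two {p : ℕ} (h : (ShortComplex.mk _ _ (diff_comp_diff D p)).Exact) :
    (mayerVietorisComplex D).ExactAt (p + 1 + 1) :=
  exactAt_succ_of_exact (mayerVietorisComplex D) (p + 1) (mayerVietorisComplex_d_succ p)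
    (mayerVietorisComplex_d_succ (p + 1)) _ h

lemma acyclic_of_exists_isPermutablyRegular
    (h : ∀ (U : X.Opens) (x : X), x ∈ U → ∃ W : X.affineOpens, (∃ f : Fin r → Γ(X, W.1),
      (∀ i, (D i).ideal W = Ideal.span {f i}) ∧ IsPermutablyRegular ⊥ f Finset.univ) ∧
        x ∈ W.1 ∧ W.1 ≤ U) :
    (mayerVietorisComplex D).Acyclic := by
  obtain ⟨B, hB, hBf⟩ : ∃ B : Set X.Opens,
      (∀ (U : X.Opens) (x : X), x ∈ U → ∃ W ∈ B, x ∈ W ∧ W ≤ U) ∧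
      ∀ W ∈ B, ∃ hW : IsAffineOpen W, ∃ f : Fin r → Γ(X, W),
        (∀ i, (D i).ideal ⟨W, hW⟩ = Ideal.span {f i}) ∧ IsPermutablyRegular ⊥ f Finset.univ := by
    -- The basis `B` is found by unification: it consists of all opens with the second property.
    refine ⟨_, fun U x hx => ?_, fun W hW => hW⟩
    obtain ⟨W, ⟨f, hf⟩, hxW, hWU⟩ := h U x hx
    exact ⟨W.1, ⟨W.2, f, hf⟩, hxW, hWU⟩
  intro i
  match i with
  | 0 =>
    refine exactAt_zero (exact_of_forall_mem_basis _ B hB fun W hWB s hs => ?_)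
    obtain ⟨hW, -⟩ := hBf W hWB
    exact ⟨0, (map_zero _).trans
      (eq_zero_of_augmentation_app_eq_zero (W := ⟨W, hW⟩) s hs).symm⟩
  | 1 =>
    refine exactAt_one (exact_of_forall_mem_basis _ B hB fun W hWB s hs => ?_)
    obtain ⟨hW, f, hf, hreg⟩ := hBf W hWB
    exact exists_augmentation_app_eq (W := ⟨W, hW⟩) hf hreg s hs
  -- Surjectivity at the right end is included, since the terms beyond it are empty biproducts.
  | p + 2 =>
    refine exactAt_add_two (exact_of_forall_mem_basis _ B hB fun W hWB s hs => ?_)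
    obtain ⟨hW, f, hf, hreg⟩ := hBf W hWB
    exact exists_diff_app_eq (W := ⟨W, hW⟩) hf hreg s hs

end Exactness

end MayerVietoris

end

theorem mainTheorem5 (k : Type u) [Field k] (X : Scheme.{u}) (π : X ⟶ Spec (CommRingCat.of k))
    [Smooth π] [IsSeparated π] [QuasiCompact π]
    {r : ℕ} (D : Fin r → X.IdealSheafData)
    (hD : ∀ i, MayerVietoris.IsEffectiveCartierDivisor (D i))
    (hcodim : ∀ S : Finset (Fin r),
      (⋂ i ∈ S, ((D i).support : Set X)) = ∅ ∨
        MayerVietoris.codim (⋂ i ∈ S, ((D i).support : Set X)) = S.card) :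
    (MayerVietoris.mayerVietorisComplex D).Acyclic := by
  refine MayerVietoris.acyclic_of_exists_isPermutablyRegular fun U x hx => ?_
  obtain ⟨W, ⟨f, hf⟩, hW⟩ := MayerVietoris.exists_affineOpens_principal D hD U x hx
  exact ⟨W, ⟨f, hf, MayerVietoris.isPermutablyRegular_of_codim k π D hcodim W f hf⟩, hW⟩
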